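/- Let $R$ be a commutative ring with $R=2R$ (that is, $2$ is invertible) and let $I$ be an ideal of $R$. Let $(P,\langle\,,\rangle)$ be a symplectic $R$-module: $P$ is a finitely generated projective $R$-module of constant rank $2n$, $n\ge 1$, and $\langle\,,\rangle$ is an alternating bilinear form on $P$ such that $x\mapsto\langle x,\cdot\rangle$ is an isomorphism $P\cong P^*$. Assume that for each maximal ideal $\mathfrak m$ of $R$ the form is given, in some basis of $P_{\mathfrak m}$, by a matrix $\varphi_{\mathfrak m}$ over $R_{\mathfrak m}$ with $\varphi_{\mathfrak m}\equiv\psi_n \pmod{I_{\mathfrak m}}$, where $\psi_n=\sum_{i=1}^n e_{2i-1,2i}-\sum_{i=1}^n e_{2i,2i-1}$. Let $Q=\mathbb H(R)\perp P=R^2\oplus P$ with the form $\langle(a_1,b_1,p_1),(a_2,b_2,p_2)\rangle=a_1b_2-a_2b_1+\langle p_1,p_2\rangle$. Let ${\rm Um}(Q,IQ)$ be the set of $v\in Q$ such that for every maximal ideal $\mathfrak m$ the image $v_{\mathfrak m}$ is unimodular in the free module $Q_{\mathfrak m}$ and $v_{\mathfrak m}\equiv(1,0,0)\pmod{I_{\mathfrak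 m}Q_{\mathfrak m}}$. *Linear transvections.* Write $Q=R\perp M$ with $M=R\oplus P$. Let ${\rm ETrans}(Q)$ be the group of automorphisms of $Q$ generated by all $(a,y)\mapsto(a,y+ax)$ with $x\in M$ and all $(a,y)\mapsto(a+\tau(y),y)$ with $\tau\in M^*$. Let ${\rm ETrans}(IQ)$ be the subgroup generated by those with $x\in IM$, respectively $\tau\in IM^*$, and let ${\rm ETrans}(Q,IQ)$ be the normal closure of ${\rm ETrans}(IQ)$ in ${\rm ETrans}(Q)$. *Symplectic transvections.* Let ${\rm ETrans}_{\rm Sp}(Q,\langle\,,\rangle)$ be the group generated by the isometries of $Q$ $$(a,b,p)\mapsto(a,\;b+\langle p,q\rangle+\alpha a,\;p+aq),\qquad (a,b,p)\mapsto(a-\langle p,q\rangle-\beta b,\;b,\;p+bq)$$ with $q\in P$ and $\alpha,\beta\in R$. Let ${\rm ETrans}_{\rm Sp}(IQ,\langle\,,\rangle)$ be the subgroup generated by those with $q\in IP$ and $\alpha,\beta\in I$, and let ${\rm ETrans}_{\rm Sp}(Q,IQ,\langle\,,\rangle)$ be the normal closure of ${\rm ETrans}_{\rm Sp}(IQ,\langle\,,\rangle)$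 in ${\rm ETrans}_{\rm Sp}(Q,\langle\,,\rangle)$. Then for every $v=(a,b,p)\in{\rm Um}(Q,IQ)$ the orbits of $v$ under the two relative groups coincide: $$(a,b,p)\,{\rm ETrans}(Q,IQ)=(a,b,p)\,{\rm ETrans}_{\rm Sp}(Q,IQ,\langle\,,\rangle).$$ -/

import Mathlib

open scoped TensorProduct

namespace TransvectionOrbits

section Unimodular

variable {R : Type*} [CommRing R] {M : Type*} [AddCommGroup M] [Module R M]

/-- `v` is unimodular: at every maximal ideal `m`, the image of `v` in `M_m = R_m ⊗ M` is a
unimodular vector, i.e. some `R_m`-linear functional (for `M_m` free: a row `w` with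
`∑ wᵢ vᵢ = 1`) takes the value `1` on it. -/
def IsUnimodular (R : Type*) [CommRing R] {M : Type*} [AddCommGroup M] [Module R M]
    (v : M) : Prop :=
  ∀ (m : Ideal R) [m.IsMaximal],
    ∃ w : Module.Dual (Localization.AtPrime m) (Localization.AtPrime m ⊗[R] M),
      w (1 ⊗ₜ[R] v) = 1

/-- The set `Um(M, IM)` with respect to a base vector `e` of `M`: the unimodular elements `v`
with `v_m ≡ e_m` modulo `I_m M_m` at every maximal ideal `m`. -/
def UmRel (I : Ideal R) (e : M) : Set M :=
  {v | IsUnimodular R v ∧ ∀ (m : Ideal R) [m.IsMaximal],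
    ((1 : Localization.AtPrime m) ⊗ₜ[R] v - (1 : Localization.AtPrime m) ⊗ₜ[R] e) ∈
      (I.map (algebraMap R (Localization.AtPrime m)) •
        (⊤ : Submodule (Localization.AtPrime m) (Localization.AtPrime m ⊗[R] M)))}

end Unimodular

/-- For subgroups `H ≤ G` of an ambient group, the normal closure of `H` in `G`, as a subgroup of
the ambient group. -/
def relNormalClosure {A : Type*} [Group A] (G H : Subgroup A) : Subgroup A :=
  (Subgroup.normalClosure ((H.subgroupOf G : Subgroup G) : Set G)).map G.subtype

section Linear

variable {R : Type*} [CommRing R] {M : Type*} [AddCommGroup M] [Module R M]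

/-- The elementary transvection `(a, p) ↦ (a, p + a x)` of `R ⊥ M`. -/
def linE (x : M) : (R × M) ≃ₗ[R] (R × M) where
  toFun z := (z.1, z.2 + z.1 • x)
  invFun z := (z.1, z.2 - z.1 • x)
  map_add' y z := by ext <;> simp [add_smul]; abel
  map_smul' c z := by ext <;> simp [mul_smul]
  left_inv z := by simp
  right_inv z := by simp

/-- The elementary transvection `(a, p) ↦ (a + τ(p), p)` of `R ⊥ M`. -/
def linEStar (τ : Module.Dual R M) : (R × M) ≃ₗ[R] (R × M) where
  toFun z := (z.1 + τ z.2, z.2)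
  invFun z := (z.1 - τ z.2, z.2)
  map_add' y z := by ext <;> simp; ring
  map_smul' c z := by ext <;> simp; ring
  left_inv z := by simp
  right_inv z := by simp

variable (R M) in
/-- `ETrans(N)` for `N = R ⊥ M`. -/
def ETrans : Subgroup ((R × M) ≃ₗ[R] (R × M)) :=
  Subgroup.closure (Set.range (linE (R := R) (M := M)) ∪ Set.range (linEStar (R := R) (M := M)))

variable (M) in
/-- `ETrans(IN)` for `N = R ⊥ M`: generated by the `E_x`, `E*_τ` with `x ∈ IM`, `τ ∈ IM*`. -/
def ETransIdeal (I : Ideal R) : Subgroup ((R × M) ≃ₗ[R] (R × M)) :=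
  Subgroup.closure
    (linE '' ((I • (⊤ : Submodule R M) : Submodule R M) : Set M) ∪
      linEStar '' ((I • (⊤ : Submodule R (Module.Dual R M)) : Submodule R (Module.Dual R M)) :
        Set (Module.Dual R M)))

variable (M) in
/-- `ETrans(N, IN)` for `N = R ⊥ M`. -/
def ETransRel (I : Ideal R) : Subgroup ((R × M) ≃ₗ[R] (R × M)) :=
  relNormalClosure (ETrans R M) (ETransIdeal M I)

end Linear

section Symplectic

variable {R : Type*} [CommRing R] {P : Type*} [AddCommGroup P] [Module R P]

variable (R P) in
/-- A non-degenerate alternating bilinear form: `x ↦ ⟨x, ·⟩` is an isomorphism `P ≅ P*`. -/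
structure SymplecticForm where
  form : LinearMap.BilinForm R P
  alt : form.IsAlt
  nondeg : Function.Bijective (fun x : P => (form x : Module.Dual R P))

/-- The alternating form `⟨(a₁, b₁, p₁), (a₂, b₂, p₂)⟩ = a₁ b₂ - a₂ b₁ + ⟨p₁, p₂⟩` of
`Q = ℍ(R) ⊥ P`, with `ℍ(R) = R ⊕ R* = R²`. -/
def formQ (B : LinearMap.BilinForm R P) : LinearMap.BilinForm R (R × R × P) :=
  LinearMap.mk₂ R (fun y z => y.1 * z.2.1 - z.1 * y.2.1 + B y.2.2 z.2.2)
    (fun x y z => by simp; ring) (fun c y z => by simp; ring)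
    (fun x y z => by simp; ring) (fun c y z => by simp; ring)

@[simp] theorem formQ_apply (B : LinearMap.BilinForm R P) (y z : R × R × P) :
    formQ B y z = y.1 * z.2.1 - z.1 * y.2.1 + B y.2.2 z.2.2 := rfl

/-- The symplectic transvection `p ↦ p + ⟨u,p⟩ v + ⟨v,p⟩ u + α ⟨u,p⟩ u` (an isometry when
`⟨u,v⟩ = 0`, for an alternating form). -/
def sympTransvection (B : LinearMap.BilinForm R P) (u v : P) (α : R) (p : P) : P :=
  p + B u p • v + B v p • u + (α * B u p) • u

/-- The elementary symplectic transvection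
`(a, b, p) ↦ (a, b + ⟨p,q⟩ + α a, p + a q)` of `Q = R² ⊥ P`. -/
def sympRho (ω : SymplecticForm R P) (q : P) (α : R) : (R × R × P) ≃ₗ[R] (R × R × P) where
  toFun z := (z.1, z.2.1 + ω.form z.2.2 q + α * z.1, z.2.2 + z.1 • q)
  invFun z := (z.1, z.2.1 - ω.form z.2.2 q - α * z.1, z.2.2 - z.1 • q)
  map_add' y z := by
    ext
    · simp
    · simp; ring
    · simp [add_smul]; abel
  map_smul' c z := by
    ext
    · simp
    · simp; ring
    · simp [mul_smul]
  left_inv z := by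
    have h := ω.alt q
    ext <;> simp [h]
    ring
  right_inv z := by
    have h := ω.alt q
    ext <;> simp [h]
    ring

/-- The elementary symplectic transvection
`(a, b, p) ↦ (a - ⟨p,q⟩ - β b, b, p + b q)` of `Q = R² ⊥ P`. -/
def sympMu (ω : SymplecticForm R P) (q : P) (β : R) : (R × R × P) ≃ₗ[R] (R × R × P) where
  toFun z := (z.1 - ω.form z.2.2 q - β * z.2.1, z.2.1, z.2.2 + z.2.1 • q)
  invFun z := (z.1 + ω.form z.2.2 q + β * z.2.1, z.2.1, z.2.2 - z.2.1 • q)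
  map_add' y z := by
    ext
    · simp; ring
    · simp
    · simp [add_smul]; abel
  map_smul' c z := by
    ext
    · simp; ring
    · simp
    · simp [mul_smul]
  left_inv z := by
    have h := ω.alt q
    ext <;> simp [h]
    ring
  right_inv z := by
    have h := ω.alt q
    ext <;> simp [h]
    ring

/-- `sympRho` is the symplectic transvection of `Q` with `u = (0, 1, 0)`, `v = (0, 0, -q)`. -/
theorem sympRho_eq (ω : SymplecticForm R P) (q : P) (α : R) (z : R × R × P) :
    sympRho ω q α z = sympTransvection (formQ ω.form) (0, 1, 0) (0, 0, -q) (-α) z := by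
  have h : ω.form q z.2.2 = -ω.form z.2.2 q := (ω.alt.neg_eq z.2.2 q).symm
  ext <;> simp [sympRho, sympTransvection, h]

/-- `sympMu` is the symplectic transvection of `Q` with `u = (-1, 0, 0)`, `v = (0, 0, -q)`. -/
theorem sympMu_eq (ω : SymplecticForm R P) (q : P) (β : R) (z : R × R × P) :
    sympMu ω q β z = sympTransvection (formQ ω.form) (-1, 0, 0) (0, 0, -q) (-β) z := by
  have h : ω.form q z.2.2 = -ω.form z.2.2 q := (ω.alt.neg_eq z.2.2 q).symm
  ext <;> simp [sympMu, sympTransvection, h]; ring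

theorem sympRho_isometry (ω : SymplecticForm R P) (q : P) (α : R) (y z : R × R × P) :
    formQ ω.form (sympRho ω q α y) (sympRho ω q α z) = formQ ω.form y z := by
  have h : ω.form q z.2.2 = -ω.form z.2.2 q := (ω.alt.neg_eq z.2.2 q).symm
  have h' := ω.alt q
  simp [sympRho, h, h']; ring

theorem sympMu_isometry (ω : SymplecticForm R P) (q : P) (β : R) (y z : R × R × P) :
    formQ ω.form (sympMu ω q β y) (sympMu ω q β z) = formQ ω.form y z := by
  have h : ω.form q z.2.2 = -ω.form z.2.2 q := (ω.alt.neg_eq z.2.2 q).symm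
  have h' := ω.alt q
  simp [sympMu, h, h']; ring

/-- `ETrans_Sp(Q)`. -/
def ETransSp (ω : SymplecticForm R P) : Subgroup ((R × R × P) ≃ₗ[R] (R × R × P)) :=
  Subgroup.closure
    ({g | ∃ (q : P) (α : R), g = sympRho ω q α} ∪ {g | ∃ (q : P) (β : R), g = sympMu ω q β})

/-- `ETrans_Sp(IQ)`: the parameters are `q ∈ IP` and `α, β ∈ I`. -/
def ETransSpIdeal (ω : SymplecticForm R P) (I : Ideal R) :
    Subgroup ((R × R × P) ≃ₗ[R] (R × R × P)) :=
  Subgroup.closure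
    ({g | ∃ q ∈ (I • ⊤ : Submodule R P), ∃ α ∈ I, g = sympRho ω q α} ∪
      {g | ∃ q ∈ (I • ⊤ : Submodule R P), ∃ β ∈ I, g = sympMu ω q β})

/-- `ETrans_Sp(Q, IQ)`. -/
def ETransSpRel (ω : SymplecticForm R P) (I : Ideal R) :
    Subgroup ((R × R × P) ≃ₗ[R] (R × R × P)) :=
  relNormalClosure (ETransSp ω) (ETransSpIdeal ω I)

/-- The standard alternating matrix `ψ_n = ∑ e_{2i-1,2i} - ∑ e_{2i,2i-1}` (indices shifted to
start at `0`). -/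
def psi (A : Type*) [CommRing A] (n : ℕ) : Matrix (Fin (2 * n)) (Fin (2 * n)) A :=
  Matrix.of fun i j =>
    if Even i.val ∧ j.val = i.val + 1 then 1
    else if Even j.val ∧ i.val = j.val + 1 then -1
    else 0

/-- At every maximal ideal `m`, the form is given in some basis of `P_m` by a matrix `φ_m` over
`R_m` with `φ_m ≡ ψ_n` modulo `I_m`. -/
def LocallyCongruentPsi (ω : SymplecticForm R P) (I : Ideal R) (n : ℕ) : Prop :=
  ∀ (m : Ideal R) [m.IsMaximal],
    ∃ b : Module.Basis (Fin (2 * n)) (Localization.AtPrime m) (Localization.AtPrime m ⊗[R] P),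
      ∀ i j, ω.form.baseChange (Localization.AtPrime m) (b i) (b j) -
          psi (Localization.AtPrime m) n i j ∈
        I.map (algebraMap R (Localization.AtPrime m))

end Symplectic

end TransvectionOrbits

/-!
Nondegeneracy turns every linear transvection of `Q = R × R × P` into some
`t(u, w) : z ↦ z + ⟨z, w⟩ u` with `⟨u, w⟩ = 0`, and `t(w, u)` is then its contragredient with
respect to the form. Put `e₁ = (1, 0, 0)` and `e₂ = (0, 1, 0)`. For `u ∈ IQ` orthogonal to `e₂`,
the product `t(u, e₂) t(e₂, u)` is a relative elementary symplectic transvection, so only the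
effect of `t(u, e₂)` on orbits matters. It reduces to showing that the relative symplectic orbit
of a unimodular `(a, b, p)` contains `(a, b + x, p)` for every `x ∈ I⟨p, P⟩`. By
unimodularity `x` is a sum of terms in `I a`, in `I⟨p, P⟩ b` and in `I⟨p, P⟩²`. The first kind is
an elementary move and the third is a polarized commutator of elementary moves. The second kind
comes from the products `diag(1 + y, 1 + y) * diag(1 - y, 1 + y)`, which act on `(a, b)` as
`diag(1, 1 + 2 y)` modulo `y²`.

The generators of the normal closure are `g t(u, w) g⁻¹ = t(g u, g' w)` with `g'` the
contragredient of `g`. Applying the above to the unit ideal shows that `g` and `g'` move `e₁` and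
`e₂` within their symplectic orbits. Hence these generators are, up to conjugation by elementary
symplectic isometries, the transvections already treated.
-/

namespace TransvectionOrbits

section NormalClosure

variable {A : Type*} [Group A] {G H K : Subgroup A}

theorem relNormalClosure_le_left : relNormalClosure G H ≤ G :=
  Subgroup.map_subtype_le _

theorem le_relNormalClosure (h : H ≤ G) : H ≤ relNormalClosure G H := fun x hx =>
  ⟨⟨x, h hx⟩, Subgroup.subset_normalClosure (Subgroup.mem_subgroupOf.2 hx), rfl⟩

theorem conj_mem_relNormalClosure {g n : A} (hg : g ∈ G) (hn : n ∈ relNormalClosure G H) :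
    g * n * g⁻¹ ∈ relNormalClosure G H := by
  obtain ⟨x, hx, rfl⟩ := hn
  exact ⟨⟨g, hg⟩ * x * ⟨g, hg⟩⁻¹, Subgroup.normalClosure_normal.conj_mem x hx _, rfl⟩

theorem le_normalizer_relNormalClosure :
    G ≤ Subgroup.normalizer (relNormalClosure G H : Set A) :=
  Subgroup.le_normalizer_iff.2 fun _ hg _ => conj_mem_relNormalClosure hg

theorem relNormalClosure_closure_le {S : Set A} (h : ∀ g ∈ G, ∀ s ∈ S, g * s * g⁻¹ ∈ K) :
    relNormalClosure G (Subgroup.closure S) ≤ K := by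
  rw [relNormalClosure, Subgroup.map_le_iff_le_comap, Subgroup.normalClosure, Subgroup.closure_le]
  intro x hx
  obtain ⟨y, hy, hyx⟩ := Group.mem_conjugatesOfSet_iff.1 hx
  obtain ⟨g, rfl⟩ := isConj_iff.1 hyx
  have hS : Subgroup.closure S ≤ K.comap (MulAut.conj (g : A)).toMonoidHom :=
    (Subgroup.closure_le _).2 fun s hs => h g g.2 s hs
  exact hS (Subgroup.mem_subgroupOf.1 hy)

theorem relNormalClosure_self (G : Subgroup A) : relNormalClosure G G = G :=
  le_antisymm relNormalClosure_le_left (le_relNormalClosure le_rfl)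

end NormalClosure

section OrbitPreserving

open MulAction

variable {A X : Type*} [Group A] [MulAction A X] {N : Subgroup A} {U : SubMulAction A X}

theorem orbit_smul_of_mem {n : A} (hn : n ∈ N) (v : X) : orbit N (n • v) = orbit N v :=
  orbit_smul (⟨n, hn⟩ : N) v

theorem orbit_smul_eq_orbit_smul_iff {k : A} (hk : k ∈ Subgroup.normalizer (N : Set A))
    {v w : X} : orbit N (k • v) = orbit N (k • w) ↔ orbit N v = orbit N w := by
  have key {k : A} (hk : k ∈ Subgroup.normalizer (N : Set A)) {v w : X}
      (h : orbit N v = orbit N w) : orbit N (k • v) = orbit N (k • w) := by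
    obtain ⟨⟨n, hn⟩, rfl⟩ := orbit_eq_iff.1 h
    simpa [mul_smul, Subgroup.smul_def] using
      orbit_smul_of_mem ((Subgroup.mem_normalizer_iff.1 hk n).1 hn) (k • w)
  exact ⟨fun h => by simpa using key (inv_mem hk) h, key hk⟩

variable (N U) in
/-- The group elements that map every point of the invariant set `U` into its own `N`-orbit. -/
def orbitPreserving : Subgroup A where
  carrier := {g | ∀ v ∈ U, orbit N (g • v) = orbit N v}
  one_mem' v _ := by rw [one_smul]
  mul_mem' {g h} hg hh v hv := by rw [mul_smul, hg _ (U.smul_mem h hv), hh v hv]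
  inv_mem' {g} hg v hv := by simpa using (hg _ (U.smul_mem g⁻¹ hv)).symm

theorem le_orbitPreserving : N ≤ orbitPreserving N U := fun _ hn v _ => orbit_smul_of_mem hn v

theorem conj_mem_orbitPreserving {k g : A} (hk : k ∈ Subgroup.normalizer (N : Set A))
    (hg : g ∈ orbitPreserving N U) : k * g * k⁻¹ ∈ orbitPreserving N U := fun v hv => by
  simpa [mul_smul] using
    (orbit_smul_eq_orbit_smul_iff hk).2 (hg _ (U.smul_mem k⁻¹ hv))

end OrbitPreserving

section Unimodular

variable {R : Type*} [CommRing R] {I : Ideal R} {M N : Type*} [AddCommGroup M] [Module R M]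
  [AddCommGroup N] [Module R N]

theorem map_mem_smul_top (f : M →ₗ[R] N) {x : M} (hx : x ∈ (I • ⊤ : Submodule R M)) :
    f x ∈ (I • ⊤ : Submodule R N) :=
  Submodule.smul_top_le_comap_smul_top I f hx

theorem map_mem_smul_top_iff (e : M ≃ₗ[R] N) {x : M} :
    e x ∈ (I • ⊤ : Submodule R N) ↔ x ∈ (I • ⊤ : Submodule R M) :=
  ⟨fun h => by simpa using map_mem_smul_top e.symm.toLinearMap h, map_mem_smul_top e.toLinearMap⟩

theorem dual_apply_mem (f : Module.Dual R M) {x : M} (hx : x ∈ (I • ⊤ : Submodule R M)) :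
    f x ∈ I := by
  simpa using map_mem_smul_top f hx

theorem mk_mem_smul_top {x : M} {y : N} (hx : x ∈ (I • ⊤ : Submodule R M))
    (hy : y ∈ (I • ⊤ : Submodule R N)) : (x, y) ∈ (I • ⊤ : Submodule R (M × N)) := by
  simpa using add_mem (map_mem_smul_top (LinearMap.inl R M N) hx)
    (map_mem_smul_top (LinearMap.inr R M N) hy)

variable (R M) in
/-- The vectors on which some functional on `M` takes the value `1`, that is, those spanning a free
direct summand of rank one. On a projective module this agrees with `IsUnimodular`, which asks for
such a functional only after localization. -/
def unimodularVectors : SubMulAction (M ≃ₗ[R] M) M where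
  carrier := {v | ∃ f : Module.Dual R M, f v = 1}
  smul_mem' g v := by
    rintro ⟨f, hf⟩
    exact ⟨f ∘ₗ g.symm.toLinearMap, by simpa using hf⟩

theorem IsUnimodular.notMem_smul_top {v : M} (hv : IsUnimodular R v) (m : Ideal R)
    [m.IsMaximal] : v ∉ (m • ⊤ : Submodule R M) := by
  intro hvm
  obtain ⟨w, hw⟩ := hv m
  have hmem := map_mem_smul_top (w.restrictScalars R ∘ₗ TensorProduct.mk R _ M 1) hvm
  rw [Ideal.smul_top_eq_map, Localization.AtPrime.map_eq_maximalIdeal] at hmem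
  exact (Ideal.ne_top_iff_one _).1 Ideal.IsPrime.ne_top' (hw ▸ hmem)

theorem mem_smul_top_of_forall_dual_apply_mem [Module.Projective R M] {v : M}
    (h : ∀ f : Module.Dual R M, f v ∈ I) : v ∈ (I • ⊤ : Submodule R M) := by
  obtain ⟨s, hs⟩ := Module.projective_def'.1 (inferInstance : Module.Projective R M)
  rw [← LinearMap.id_apply (R := R) v, ← hs, LinearMap.comp_apply,
    Finsupp.linearCombination_apply]
  exact Submodule.sum_mem _ fun i _ => Submodule.smul_mem_smul (h (Finsupp.lapply i ∘ₗ s)) trivial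

theorem IsUnimodular.mem_unimodularVectors [Module.Projective R M] {v : M}
    (hv : IsUnimodular R v) : v ∈ unimodularVectors R M := by
  let values : Ideal R := LinearMap.range (Module.Dual.eval R M v)
  suffices hvalues : values = ⊤ from (Ideal.eq_top_iff_one values).1 hvalues
  by_contra hne
  obtain ⟨m, hm, hvm⟩ := Ideal.exists_le_maximal values hne
  exact hv.notMem_smul_top m
    (mem_smul_top_of_forall_dual_apply_mem fun f => hvm ⟨f, rfl⟩)

end Unimodular

namespace SymplecticForm

variable {R : Type*} [CommRing R] {I : Ideal R} {P : Type*} [AddCommGroup P] [Module R P]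

theorem form_self (ω : SymplecticForm R P) (x : P) : ω.form x x = 0 := ω.alt x

theorem form_swap (ω : SymplecticForm R P) (x y : P) : ω.form x y = -ω.form y x :=
  (ω.alt.neg_eq y x).symm

theorem form_eq_zero_comm (ω : SymplecticForm R P) {x y : P} :
    ω.form x y = 0 ↔ ω.form y x = 0 := by
  rw [ω.form_swap, neg_eq_zero]

theorem exists_form_eq (ω : SymplecticForm R P) {φ : Module.Dual R P}
    (hφ : φ ∈ (I • ⊤ : Submodule R (Module.Dual R P))) :
    ∃ q ∈ (I • ⊤ : Submodule R P), ∀ p, ω.form p q = φ p := by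
  let e : P ≃ₗ[R] Module.Dual R P := LinearEquiv.ofBijective ω.form ω.nondeg
  refine ⟨-e.symm φ, neg_mem (map_mem_smul_top e.symm.toLinearMap hφ), fun p => ?_⟩
  rw [ω.form_swap, map_neg, LinearMap.neg_apply, neg_neg]
  exact LinearMap.congr_fun (e.apply_symm_apply φ) p

/-- The symplectic form `formQ ω.form` of `ℍ(R) ⊥ P`. -/
def addHyperbolic (ω : SymplecticForm R P) : SymplecticForm R (R × R × P) where
  form := formQ ω.form
  alt z := by simp [ω.form_self]
  nondeg := by
    refine ⟨(injective_iff_map_eq_zero (formQ ω.form)).2 fun z hz => ?_, fun φ => ?_⟩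
    · have hform (y : R × R × P) : formQ ω.form z y = 0 := LinearMap.congr_fun hz y
      refine Prod.ext ?_ (Prod.ext ?_ (ω.nondeg.1 ?_))
      · simpa using hform (0, 1, 0)
      · simpa using hform (1, 0, 0)
      · ext q
        simpa using hform (0, 0, q)
    · obtain ⟨q, hq⟩ := ω.nondeg.2 (φ ∘ₗ LinearMap.inr R R (R × P) ∘ₗ LinearMap.inr R R P)
      refine ⟨(φ (0, 1, 0), -φ (1, 0, 0), q), LinearMap.ext fun ⟨a, b, p⟩ => ?_⟩
      have hp : ω.form q p = φ (0, 0, p) := LinearMap.congr_fun hq p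
      have hdecomp : ((a, b, p) : R × R × P) = a • (1, 0, 0) + b • (0, 1, 0) + (0, 0, p) := by
        simp
      rw [hdecomp, map_add φ, map_add φ, map_smul, map_smul]
      simp [hp]
      ring

@[simp] theorem addHyperbolic_form_apply (ω : SymplecticForm R P) (y z : R × R × P) :
    ω.addHyperbolic.form y z = y.1 * z.2.1 - z.1 * y.2.1 + ω.form y.2.2 z.2.2 := rfl

/-- The transvection `z ↦ z + ⟨z, w⟩ u` for `u` orthogonal to `w`. Letting `w` range over `P` yields
all functionals, so this covers every linear transvection with direction `u`. -/
def transvection (ω : SymplecticForm R P) {w u : P} (h : ω.form u w = 0) : P ≃ₗ[R] P :=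
  LinearEquiv.transvection (f := ω.form.flip w) (v := u) h

@[simp] theorem transvection_apply (ω : SymplecticForm R P) {w u : P} (h : ω.form u w = 0)
    (z : P) : ω.transvection h z = z + ω.form z w • u := rfl

theorem form_transvection_transvection (ω : SymplecticForm R P) {w u : P} (h : ω.form u w = 0)
    (h' : ω.form w u = 0) (y z : P) :
    ω.form (ω.transvection h y) (ω.transvection h' z) = ω.form y z := by
  simp only [transvection_apply, map_add, map_smul, LinearMap.add_apply, LinearMap.smul_apply, h,
    smul_eq_mul, ω.form_swap u z]
  ring

theorem conj_transvection (ω : SymplecticForm R P) {g g' : P ≃ₗ[R] P}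
    (hg : ∀ y z, ω.form (g y) (g' z) = ω.form y z) {w u : P} (h : ω.form u w = 0) :
    g * ω.transvection h * g⁻¹ = ω.transvection ((hg u w).trans h) := by
  rw [mul_inv_eq_iff_eq_mul]
  ext z
  simp [hg]

end SymplecticForm

section LinearTransvections

open scoped commutatorElement

variable {R : Type*} [CommRing R] {I : Ideal R} {M : Type*} [AddCommGroup M] [Module R M]

@[simp] theorem linE_apply (x : M) (z : R × M) : linE x z = (z.1, z.2 + z.1 • x) := rfl

@[simp] theorem linE_inv_apply (x : M) (z : R × M) :
    (linE (R := R) x)⁻¹ z = (z.1, z.2 - z.1 • x) := rfl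

@[simp] theorem linEStar_apply (τ : Module.Dual R M) (z : R × M) :
    linEStar τ z = (z.1 + τ z.2, z.2) := rfl

@[simp] theorem linEStar_inv_apply (τ : Module.Dual R M) (z : R × M) :
    (linEStar τ)⁻¹ z = (z.1 - τ z.2, z.2) := rfl

theorem ETransIdeal_top : ETransIdeal M (⊤ : Ideal R) = ETrans R M := by
  simp [ETransIdeal, ETrans]

theorem ETransIdeal_le_ETrans : ETransIdeal M I ≤ ETrans R M :=
  Subgroup.closure_mono (Set.union_subset_union (Set.image_subset_range _ _)
    (Set.image_subset_range _ _))

theorem ETransRel_top : ETransRel M (⊤ : Ideal R) = ETrans R M := by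
  rw [ETransRel, ETransIdeal_top, relNormalClosure_self]

theorem linE_mem_ETransRel {x : M} (hx : x ∈ (I • ⊤ : Submodule R M)) : linE x ∈ ETransRel M I :=
  le_relNormalClosure ETransIdeal_le_ETrans (Subgroup.subset_closure (Or.inl ⟨x, hx, rfl⟩))

theorem linEStar_mem_ETransRel {τ : Module.Dual R M}
    (hτ : τ ∈ (I • ⊤ : Submodule R (Module.Dual R M))) : linEStar τ ∈ ETransRel M I :=
  le_relNormalClosure ETransIdeal_le_ETrans (Subgroup.subset_closure (Or.inr ⟨τ, hτ, rfl⟩))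

theorem commutator_linE_linEStar_apply {x : M} {φ : Module.Dual R M} (h : φ x = 0) (z : R × M) :
    ⁅linE (R := R) x, linEStar φ⁆ z = (z.1, z.2 + φ z.2 • x) := by
  simp only [commutatorElement_def, LinearEquiv.mul_apply, linE_apply, linE_inv_apply,
    linEStar_apply, linEStar_inv_apply, map_sub, map_smul, h, smul_zero, sub_zero, sub_add_cancel]
  refine Prod.ext rfl ?_
  module

theorem commutator_linE_linEStar_mem_ETransRel {x : M} {φ : Module.Dual R M}
    (h : x ∈ (I • ⊤ : Submodule R M) ∨ φ ∈ (I • ⊤ : Submodule R (Module.Dual R M))) :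
    ⁅linE (R := R) x, linEStar φ⁆ ∈ ETransRel M I := by
  rw [commutatorElement_def]
  rcases h with hx | hφ
  · simpa [mul_assoc] using mul_mem (linE_mem_ETransRel hx)
      (conj_mem_relNormalClosure (Subgroup.subset_closure (Or.inr ⟨φ, rfl⟩))
        (inv_mem (linE_mem_ETransRel hx)))
  · exact mul_mem
      (conj_mem_relNormalClosure (Subgroup.subset_closure (Or.inl ⟨x, rfl⟩))
        (linEStar_mem_ETransRel hφ))
      (inv_mem (linEStar_mem_ETransRel hφ))

end LinearTransvections

section ElementarySymplectic

open scoped commutatorElement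

variable {R : Type*} [CommRing R] {I : Ideal R} {P : Type*} [AddCommGroup P] [Module R P]
variable {ω : SymplecticForm R P}

@[simp] theorem sympRho_apply (q : P) (α : R) (z : R × R × P) :
    sympRho ω q α z = (z.1, z.2.1 + ω.form z.2.2 q + α * z.1, z.2.2 + z.1 • q) := rfl

@[simp] theorem sympMu_apply (q : P) (β : R) (z : R × R × P) :
    sympMu ω q β z = (z.1 - ω.form z.2.2 q - β * z.2.1, z.2.1, z.2.2 + z.2.1 • q) := rfl

@[simp] theorem sympRho_inv_apply (q : P) (α : R) (z : R × R × P) :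
    (sympRho ω q α)⁻¹ z = (z.1, z.2.1 - ω.form z.2.2 q - α * z.1, z.2.2 - z.1 • q) := rfl

@[simp] theorem sympMu_inv_apply (q : P) (β : R) (z : R × R × P) :
    (sympMu ω q β)⁻¹ z = (z.1 + ω.form z.2.2 q + β * z.2.1, z.2.1, z.2.2 - z.2.1 • q) := rfl

theorem sympRho_mem_ETransSp (q : P) (α : R) : sympRho ω q α ∈ ETransSp ω :=
  Subgroup.subset_closure (Or.inl ⟨q, α, rfl⟩)

theorem sympMu_mem_ETransSp (q : P) (β : R) : sympMu ω q β ∈ ETransSp ω :=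
  Subgroup.subset_closure (Or.inr ⟨q, β, rfl⟩)

theorem ETransSpIdeal_le_ETransSp : ETransSpIdeal ω I ≤ ETransSp ω := by
  refine (Subgroup.closure_le _).2 ?_
  rintro _ (⟨q, -, α, -, rfl⟩ | ⟨q, -, β, -, rfl⟩)
  exacts [sympRho_mem_ETransSp q α, sympMu_mem_ETransSp q β]

theorem ETransSpRel_top : ETransSpRel ω ⊤ = ETransSp ω := by
  have htop : ETransSpIdeal ω ⊤ = ETransSp ω := by simp [ETransSpIdeal, ETransSp]
  rw [ETransSpRel, htop, relNormalClosure_self]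

theorem sympRho_mem_ETransSpRel {q : P} (hq : q ∈ (I • ⊤ : Submodule R P)) {α : R} (hα : α ∈ I) :
    sympRho ω q α ∈ ETransSpRel ω I :=
  le_relNormalClosure ETransSpIdeal_le_ETransSp
    (Subgroup.subset_closure (Or.inl ⟨q, hq, α, hα, rfl⟩))

theorem sympMu_mem_ETransSpRel {q : P} (hq : q ∈ (I • ⊤ : Submodule R P)) {β : R} (hβ : β ∈ I) :
    sympMu ω q β ∈ ETransSpRel ω I :=
  le_relNormalClosure ETransSpIdeal_le_ETransSp
    (Subgroup.subset_closure (Or.inr ⟨q, hq, β, hβ, rfl⟩))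

theorem formQ_map {k : (R × R × P) ≃ₗ[R] (R × R × P)} (hk : k ∈ ETransSp ω) (y z : R × R × P) :
    formQ ω.form (k y) (k z) = formQ ω.form y z := by
  induction hk using Subgroup.closure_induction generalizing y z with
  | mem x hx =>
    rcases hx with ⟨q, α, rfl⟩ | ⟨q, β, rfl⟩
    exacts [sympRho_isometry ω q α y z, sympMu_isometry ω q β y z]
  | one => rfl
  | mul g h _ _ hg hh => exact (hg _ _).trans (hh _ _)
  | inv g _ hg => simpa [← LinearEquiv.mul_apply] using (hg (g⁻¹ y) (g⁻¹ z)).symm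

theorem flip_comp_snd_mem_smul_top {q : P} (hq : q ∈ (I • ⊤ : Submodule R P)) :
    ω.form.flip q ∘ₗ LinearMap.snd R R P ∈ (I • ⊤ : Submodule R (Module.Dual R (R × P))) :=
  map_mem_smul_top ((LinearMap.lcomp R R (LinearMap.snd R R P)) ∘ₗ ω.form.flip) hq

theorem sympRho_mem_ETransRel {q : P} (hq : q ∈ (I • ⊤ : Submodule R P)) {α : R} (hα : α ∈ I) :
    sympRho ω q α ∈ ETransRel (R × P) I := by
  have hfactor : sympRho ω q α =
      linE (R := R) (α, q) *
        ⁅linE (R := R) ((1, 0) : R × P), linEStar (ω.form.flip q ∘ₗ LinearMap.snd R R P)⁆ := by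
    refine LinearEquiv.ext fun z => ?_
    rw [LinearEquiv.mul_apply, commutator_linE_linEStar_apply (by simp)]
    ext <;> simp [mul_comm]
  rw [hfactor]
  exact mul_mem (linE_mem_ETransRel (mk_mem_smul_top (by simpa using hα) hq))
    (commutator_linE_linEStar_mem_ETransRel (.inr (flip_comp_snd_mem_smul_top hq)))

theorem sympMu_mem_ETransRel {q : P} (hq : q ∈ (I • ⊤ : Submodule R P)) {β : R} (hβ : β ∈ I) :
    sympMu ω q β ∈ ETransRel (R × P) I := by
  have hfactor : sympMu ω q β =
      linEStar (-(β • LinearMap.fst R R P + ω.form.flip q ∘ₗ LinearMap.snd R R P)) *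
        ⁅linE (R := R) ((0, q) : R × P), linEStar (LinearMap.fst R R P)⁆ := by
    refine LinearEquiv.ext fun z => ?_
    rw [LinearEquiv.mul_apply, commutator_linE_linEStar_apply (by simp)]
    ext <;> simp [ω.form_self]
    ring
  rw [hfactor]
  exact mul_mem
    (linEStar_mem_ETransRel <| neg_mem <|
      add_mem (Submodule.smul_mem_smul hβ trivial) (flip_comp_snd_mem_smul_top hq))
    (commutator_linE_linEStar_mem_ETransRel (.inl (mk_mem_smul_top (zero_mem _) hq)))

theorem ETransSpIdeal_le_ETransRel (ω : SymplecticForm R P) (I : Ideal R) :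
    ETransSpIdeal ω I ≤ ETransRel (R × P) I := by
  refine (Subgroup.closure_le _).2 ?_
  rintro _ (⟨q, hq, α, hα, rfl⟩ | ⟨q, hq, β, hβ, rfl⟩)
  exacts [sympRho_mem_ETransRel hq hα, sympMu_mem_ETransRel hq hβ]

theorem ETransSp_le_ETrans (ω : SymplecticForm R P) : ETransSp ω ≤ ETrans R (R × P) := by
  refine (Subgroup.closure_le _).2 ?_
  rw [← ETransRel_top]
  rintro _ (⟨q, α, rfl⟩ | ⟨q, β, rfl⟩)
  exacts [sympRho_mem_ETransRel (by simp) trivial, sympMu_mem_ETransRel (by simp) trivial]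

theorem ETransSpRel_le_ETransRel (ω : SymplecticForm R P) (I : Ideal R) :
    ETransSpRel ω I ≤ ETransRel (R × P) I :=
  relNormalClosure_closure_le fun _ hg _ hs =>
    conj_mem_relNormalClosure (ETransSp_le_ETrans ω hg)
      (ETransSpIdeal_le_ETransRel ω I (Subgroup.subset_closure hs))

theorem exists_rotation_mem_ETransSp (ω : SymplecticForm R P) :
    ∃ g ∈ ETransSp ω, ∀ (a b : R) (p : P), g (a, b, p) = (b, -a, p) := by
  refine ⟨sympMu ω 0 (-1) * sympRho ω 0 (-1) * sympMu ω 0 (-1),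
    mul_mem (mul_mem (sympMu_mem_ETransSp _ _) (sympRho_mem_ETransSp _ _))
      (sympMu_mem_ETransSp _ _), fun a b p => ?_⟩
  simp [LinearEquiv.mul_apply]

end ElementarySymplectic

section SymplecticOrbits

variable {R : Type*} [CommRing R] {I : Ideal R} {P : Type*} [AddCommGroup P] [Module R P]
variable {ω : SymplecticForm R P}

/-- The orbit of `v` under `ETransSpRel ω I`. -/
abbrev spOrbit (ω : SymplecticForm R P) (I : Ideal R) (v : R × R × P) : Set (R × R × P) :=
  MulAction.orbit (ETransSpRel ω I) v

variable (ω) in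
/-- The ideal of all values `⟨p, q⟩` with `q ∈ P`. -/
def formIdeal (p : P) : Ideal R := LinearMap.range (ω.form p)

theorem mem_mul_formIdeal {p : P} {x : R} :
    x ∈ I * formIdeal ω p ↔ ∃ q ∈ (I • ⊤ : Submodule R P), ω.form p q = x := by
  rw [formIdeal, ← Submodule.map_top, ← smul_eq_mul, ← Submodule.map_smul'', Submodule.mem_map]

theorem mul_sq_mem_mul_sq {J : Ideal R} {x : R} (hx : x ∈ I * J) (r : R) :
    r * x ^ 2 ∈ I * J ^ 2 := by
  rw [pow_two, pow_two, ← mul_assoc]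
  exact Ideal.mul_mem_left _ _ (Ideal.mul_mem_mul hx (Ideal.mul_le_right hx))

theorem spOrbit_apply_of_mem {g : (R × R × P) ≃ₗ[R] (R × R × P)} (hg : g ∈ ETransSpRel ω I)
    (v : R × R × P) : spOrbit ω I (g v) = spOrbit ω I v :=
  orbit_smul_of_mem hg v

theorem spOrbit_apply_eq_iff {k : (R × R × P) ≃ₗ[R] (R × R × P)} (hk : k ∈ ETransSp ω)
    {v w : R × R × P} : spOrbit ω I (k v) = spOrbit ω I (k w) ↔ spOrbit ω I v = spOrbit ω I w :=
  orbit_smul_eq_orbit_smul_iff (le_normalizer_relNormalClosure hk)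

theorem spOrbit_rho {q : P} (hq : q ∈ (I • ⊤ : Submodule R P)) {α : R} (hα : α ∈ I)
    (a b : R) (p : P) :
    spOrbit ω I (a, b + ω.form p q + α * a, p + a • q) = spOrbit ω I (a, b, p) :=
  spOrbit_apply_of_mem (sympRho_mem_ETransSpRel hq hα) (a, b, p)

theorem spOrbit_mu {q : P} (hq : q ∈ (I • ⊤ : Submodule R P)) {β : R} (hβ : β ∈ I)
    (a b : R) (p : P) :
    spOrbit ω I (a - ω.form p q - β * b, b, p + b • q) = spOrbit ω I (a, b, p) :=
  spOrbit_apply_of_mem (sympMu_mem_ETransSpRel hq hβ) (a, b, p)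

theorem spOrbit_add_mul_right {α : R} (hα : α ∈ I) (a b : R) (p : P) :
    spOrbit ω I (a, b + α * a, p) = spOrbit ω I (a, b, p) := by
  simpa using spOrbit_rho (ω := ω) (zero_mem _) hα a b p

theorem spOrbit_add_mul_left {β : R} (hβ : β ∈ I) (a b : R) (p : P) :
    spOrbit ω I (a + β * b, b, p) = spOrbit ω I (a, b, p) := by
  simpa using spOrbit_mu (ω := ω) (zero_mem _) (neg_mem hβ) a b p

theorem spOrbit_rotate_eq_iff {a b a' b' : R} {p p' : P} :
    spOrbit ω I (b, -a, p) = spOrbit ω I (b', -a', p') ↔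
      spOrbit ω I (a, b, p) = spOrbit ω I (a', b', p') := by
  obtain ⟨k, hk, hrot⟩ := exists_rotation_mem_ETransSp ω
  rw [← hrot, ← hrot, spOrbit_apply_eq_iff hk]

theorem spOrbit_add_form_smul (h2 : IsUnit (2 : R)) {α : R} {x : P}
    (hx : α • x ∈ (I • ⊤ : Submodule R P)) (a b : R) (p : P) :
    spOrbit ω I (a, b, p + (α * ω.form p x) • x) = spOrbit ω I (a, b, p) := by
  obtain ⟨c, hc⟩ := h2.exists_right_inv
  obtain ⟨β, hβ⟩ : ∃ β, α = -(2 * β) := ⟨-(c * α), by linear_combination -α * hc⟩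
  have hβx : β • x ∈ (I • ⊤ : Submodule R P) := by
    have : β • x = (-c) • α • x := by
      rw [smul_smul]
      congr 1
      linear_combination -β * hc + c * hβ
    exact this ▸ Submodule.smul_mem _ _ hx
  have hμ : sympMu ω (β • x) 0 ∈ ETransSpRel ω I := sympMu_mem_ETransSpRel hβx (zero_mem _)
  have hconj : sympRho ω x 0 * sympMu ω (β • x) 0 * (sympRho ω x 0)⁻¹ ∈ ETransSpRel ω I :=
    conj_mem_relNormalClosure (sympRho_mem_ETransSp x 0) hμ
  rw [← spOrbit_apply_of_mem (mul_mem hconj (inv_mem hμ)) (a, b, p)]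
  congr 1
  simp only [LinearEquiv.mul_apply, sympRho_apply, sympMu_apply, sympRho_inv_apply,
    sympMu_inv_apply, map_add, map_sub, map_smul, LinearMap.add_apply, LinearMap.sub_apply,
    LinearMap.smul_apply, ω.form_self x, smul_eq_mul, hβ]
  refine Prod.ext ?_ (Prod.ext ?_ ?_)
  · ring
  · ring
  · module

theorem spOrbit_add_mul_form_sq (h2 : IsUnit (2 : R)) {α : R} (hα : α ∈ I) (y : P) (a b : R)
    (p : P) : spOrbit ω I (a, b + α * ω.form p y ^ 2, p) = spOrbit ω I (a, b, p) := by
  have hmem (r : R) : (r * α) • y ∈ (I • ⊤ : Submodule R P) :=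
    Submodule.smul_mem_smul (I.mul_mem_left r hα) trivial
  rw [← (spOrbit_add_form_smul h2 (hmem (-a)) _ _ _).trans
    (spOrbit_rho (hmem (ω.form p y)) (zero_mem I) a b p)]
  congr 3
  · simp
    ring
  · simp only [map_add, map_smul, LinearMap.add_apply, LinearMap.smul_apply, ω.form_self y,
      smul_eq_mul]
    module

theorem spOrbit_add_right_of_mem_mul_sq (h2 : IsUnit (2 : R)) {a : R} {p : P} {x : R}
    (hx : x ∈ I * formIdeal ω p ^ 2) (b : R) :
    spOrbit ω I (a, b + x, p) = spOrbit ω I (a, b, p) := by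
  obtain ⟨c, hc⟩ := h2.exists_right_inv
  induction hx using Submodule.mul_induction_on' generalizing b with
  | mem_mul_mem α hα j hj =>
    rw [pow_two] at hj
    induction hj using Submodule.mul_induction_on' generalizing b with
    | mem_mul_mem _ hy _ hz =>
      obtain ⟨y, rfl⟩ := hy
      obtain ⟨z, rfl⟩ := hz
      have hαc : c ^ 2 * α ∈ I := I.mul_mem_left _ hα
      -- polarization: `4 ⟨p, y⟩ ⟨p, z⟩ = ⟨p, y + z⟩ ^ 2 - ⟨p, y - z⟩ ^ 2`
      rw [← (spOrbit_add_mul_form_sq h2 (neg_mem hαc) (y - z) _ _ _).trans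
        (spOrbit_add_mul_form_sq h2 hαc (y + z) a b p)]
      congr 3
      simp only [map_add, map_sub]
      linear_combination -α * ω.form p y * ω.form p z * (2 * c + 1) * hc
    | add x _ y _ hx hy => rw [mul_add, ← add_assoc, hy, hx]
  | add x _ y _ hx hy => rw [← add_assoc, hy, hx]

theorem spOrbit_add_left_of_mem_mul_sq (h2 : IsUnit (2 : R)) {b : R} {p : P} {x : R}
    (hx : x ∈ I * formIdeal ω p ^ 2) (a : R) :
    spOrbit ω I (a + x, b, p) = spOrbit ω I (a, b, p) := by
  rw [← spOrbit_rotate_eq_iff, neg_add]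
  exact spOrbit_add_right_of_mem_mul_sq h2 (neg_mem hx) _

theorem spOrbit_eq_of_sub_mem (h2 : IsUnit (2 : R)) {a a' b b' : R} {p : P}
    (ha : a' - a ∈ I * formIdeal ω p ^ 2) (hb : b' - b ∈ I * formIdeal ω p ^ 2) :
    spOrbit ω I (a', b', p) = spOrbit ω I (a, b, p) := by
  rw [← add_sub_cancel a a', ← add_sub_cancel b b', spOrbit_add_left_of_mem_mul_sq h2 ha,
    spOrbit_add_right_of_mem_mul_sq h2 hb]

theorem spOrbit_scale (h2 : IsUnit (2 : R)) {p : P} {x : R} (hx : x ∈ I * formIdeal ω p)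
    (a b : R) :
    spOrbit ω I ((1 + x) * a, (1 + x) * b, p) = spOrbit ω I (a, b, p) := by
  obtain ⟨q, hq, rfl⟩ := mem_mul_formIdeal.1 hx
  have hρ := spOrbit_rho (ω := ω) (Submodule.smul_mem _ b hq) (zero_mem I) a b p
  have hμ := (spOrbit_mu (Submodule.smul_mem _ (-a) hq) (zero_mem I) _ _ _).trans hρ
  rw [← (spOrbit_add_form_smul h2 (Submodule.smul_mem _ (a * b) hq) _ _ _).trans hμ]
  congr 1
  refine Prod.ext ?_ (Prod.ext ?_ ?_)
  · simp [ω.form_self]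
    ring
  · simp
    ring
  · simp only [map_add, map_smul, LinearMap.add_apply, LinearMap.smul_apply, ω.form_self q,
      smul_eq_mul]
    module

theorem spOrbit_unipotent {x : R} (hx : x ∈ I) (a b : R) (p : P) :
    spOrbit ω I (a * (1 - x) + b * x, b * (1 + x) - a * x, p) = spOrbit ω I (a, b, p) := by
  have h := spOrbit_add_mul_right (ω := ω) (neg_mem hx) (a - b) b p
  rw [← spOrbit_apply_eq_iff (sympMu_mem_ETransSp 0 (-1))] at h
  convert h using 2
  · simp
    constructor <;> ring
  · simp

theorem spOrbit_diagonal (h2 : IsUnit (2 : R)) {p : P} {x : R} (hx : x ∈ I * formIdeal ω p)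
    (a b : R) : spOrbit ω I ((1 - x) * a, (1 + x) * b, p) = spOrbit ω I (a, b, p) := by
  have hxI : x ∈ I := Ideal.mul_le_left hx
  -- clearing the off-diagonal entries of `1 + x * !![-1, 1; -1, 1]` leaves `diag(1 - x, 1 + x)`
  -- up to multiples of `x ^ 2`
  rw [← ((spOrbit_add_mul_left (neg_mem hxI) _ _ _).trans
    (spOrbit_add_mul_right hxI _ _ _)).trans (spOrbit_unipotent hxI a b p)]
  refine spOrbit_eq_of_sub_mem h2 ?_ ?_
  · convert mul_sq_mem_mul_sq hx (-x * a + (1 + x) * b) using 1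
    ring
  · convert mul_sq_mem_mul_sq hx (a - b) using 1
    ring

theorem spOrbit_add_mul_right_of_mem_mul (h2 : IsUnit (2 : R)) {p : P} {x : R}
    (hx : x ∈ I * formIdeal ω p) (a b : R) :
    spOrbit ω I (a, b + x * b, p) = spOrbit ω I (a, b, p) := by
  obtain ⟨c, hc⟩ := h2.exists_right_inv
  have hcx : c * x ∈ I * formIdeal ω p := Ideal.mul_mem_left _ c hx
  rw [← (spOrbit_diagonal h2 hcx _ _).trans (spOrbit_scale h2 hcx a b)]
  refine spOrbit_eq_of_sub_mem h2 ?_ ?_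
  · convert mul_sq_mem_mul_sq hcx a using 1
    ring
  · convert mul_sq_mem_mul_sq hcx (-b) using 1
    linear_combination -x * b * hc

theorem spOrbit_add_right_of_mem_mul (h2 : IsUnit (2 : R)) {a b : R} {p : P}
    (hv : (a, b, p) ∈ unimodularVectors R (R × R × P)) {x : R} (hx : x ∈ I * formIdeal ω p) :
    spOrbit ω I (a, b + x, p) = spOrbit ω I (a, b, p) := by
  obtain ⟨f, hf⟩ := hv
  obtain ⟨q, -, hq⟩ := ω.exists_form_eq (I := ⊤)
    (φ := f ∘ₗ LinearMap.inr R R (R × P) ∘ₗ LinearMap.inr R R P) (by simp)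
  obtain ⟨r, s, hrs⟩ : ∃ r s, r * a + s * b + ω.form p q = 1 := by
    refine ⟨f (1, 0, 0), f (0, 1, 0), ?_⟩
    have hdecomp : ((a, b, p) : R × R × P) = a • (1, 0, 0) + b • (0, 1, 0) + (0, 0, p) := by
      simp
    rw [hdecomp, map_add, map_add, map_smul, map_smul] at hf
    simpa [hq, mul_comm] using hf
  have hxq : x * ω.form p q ∈ I * formIdeal ω p ^ 2 := by
    rw [pow_two, ← mul_assoc]
    exact Ideal.mul_mem_mul hx ⟨q, rfl⟩
  rw [← ((spOrbit_add_right_of_mem_mul_sq h2 hxq _).trans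
    (spOrbit_add_mul_right (I.mul_mem_left r (Ideal.mul_le_left hx)) _ _ _)).trans
    (spOrbit_add_mul_right_of_mem_mul h2 (Ideal.mul_mem_left _ s hx) a b)]
  congr 3
  linear_combination -x * hrs

end SymplecticOrbits

section OrbitComparison

variable {R : Type*} [CommRing R] {I : Ideal R} {P : Type*} [AddCommGroup P] [Module R P]
variable {ω : SymplecticForm R P}

/-- The automorphisms of `R × R × P` that map every unimodular vector into its own orbit under
`ETransSpRel ω I`. -/
abbrev spOrbitPreserving (ω : SymplecticForm R P) (I : Ideal R) :
    Subgroup ((R × R × P) ≃ₗ[R] (R × R × P)) :=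
  orbitPreserving (ETransSpRel ω I) (unimodularVectors R (R × R × P))

theorem linE_mem_spOrbitPreserving (h2 : IsUnit (2 : R)) {x : R × P}
    (hx : x ∈ (I • ⊤ : Submodule R (R × P))) : linE x ∈ spOrbitPreserving ω I := by
  obtain ⟨c, q⟩ := x
  have hc : c ∈ I := dual_apply_mem (LinearMap.fst R R P) hx
  have hq : q ∈ (I • ⊤ : Submodule R P) := map_mem_smul_top (LinearMap.snd R R P) hx
  rintro ⟨a, b, p⟩ hv
  have hv' : (a, b + a * c, p + a • q) ∈ unimodularVectors R (R × R × P) :=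
    SubMulAction.smul_mem _ (linE (c, q)) hv
  calc
    spOrbit ω I (a, b + a * c, p + a • q)
      = spOrbit ω I (a, b + a * c + ω.form (p + a • q) q, p + a • q) :=
        (spOrbit_add_right_of_mem_mul h2 hv' (mem_mul_formIdeal.2 ⟨q, hq, rfl⟩)).symm
    _ = spOrbit ω I (a, b + ω.form p q + c * a, p + a • q) := by
        congr 3
        simp [ω.form_self]
        ring
    _ = spOrbit ω I (a, b, p) := spOrbit_rho hq hc a b p

theorem linE_eq_transvection (ω : SymplecticForm R P) (x : R × P) :
    linE x = ω.addHyperbolic.transvection (w := (0, 1, 0)) (u := (0, x)) (by simp) := by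
  ext <;> simp

theorem exists_linEStar_eq_transvection (ω : SymplecticForm R P) {τ : Module.Dual R (R × P)}
    (hτ : τ ∈ (I • ⊤ : Submodule R (Module.Dual R (R × P)))) :
    ∃ w ∈ (I • ⊤ : Submodule R (R × R × P)), ∃ h : ω.addHyperbolic.form (1, 0, 0) w = 0,
      linEStar τ = ω.addHyperbolic.transvection h := by
  obtain ⟨w, hw, hform⟩ := ω.addHyperbolic.exists_form_eq
    (map_mem_smul_top (LinearMap.lcomp R R (LinearMap.snd R R (R × P))) hτ)
  refine ⟨w, hw, (hform _).trans (map_zero τ), LinearEquiv.ext fun z => ?_⟩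
  rw [SymplecticForm.transvection_apply, hform]
  ext <;> simp

theorem sympRho_two_mul (ω : SymplecticForm R P) (c : R) (q : P) :
    sympRho ω q (2 * c) =
      linE (c, q) * ω.addHyperbolic.transvection (w := (0, c, q)) (u := (0, 1, 0)) (by simp) := by
  ext <;> simp
  ring

theorem spOrbit_top_eq_iff {v w : R × R × P} :
    spOrbit ω ⊤ w = spOrbit ω ⊤ v ↔ ∃ k ∈ ETransSp ω, k v = w := by
  rw [MulAction.orbit_eq_iff, ← ETransSpRel_top]
  exact ⟨fun ⟨⟨k, hk⟩, h⟩ => ⟨k, hk, h⟩, fun ⟨k, hk, h⟩ => ⟨⟨k, hk⟩, h⟩⟩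

theorem spOrbit_top_one_zero_zero :
    spOrbit ω ⊤ ((1, 0, 0) : R × R × P) = spOrbit ω ⊤ (0, 1, 0) := by
  obtain ⟨k, hk, hrot⟩ := exists_rotation_mem_ETransSp ω
  exact spOrbit_top_eq_iff.2 ⟨k, hk, by simp [hrot]⟩

theorem exists_mem_ETransSp_apply_eq {u v : R × R × P}
    (hv : spOrbit ω ⊤ v = spOrbit ω ⊤ (0, 1, 0))
    (hu : u ∈ (I • ⊤ : Submodule R (R × R × P))) (h : ω.addHyperbolic.form u v = 0) :
    ∃ k ∈ ETransSp ω, ∃ x ∈ (I • ⊤ : Submodule R (R × P)), k (0, 1, 0) = v ∧ k (0, x) = u := by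
  obtain ⟨k, hk, rfl⟩ := spOrbit_top_eq_iff.1 hv
  obtain ⟨⟨r, x⟩, rfl⟩ := k.surjective u
  obtain rfl : r = 0 := by simpa using (formQ_map hk (r, x) (0, 1, 0)).symm.trans h
  exact ⟨k, hk, x, map_mem_smul_top (LinearMap.snd R R (R × P))
    ((map_mem_smul_top_iff k).1 hu), rfl, rfl⟩

theorem transvection_mem_spOrbitPreserving_of_direction_mem (h2 : IsUnit (2 : R))
    {u v : R × R × P} (hv : spOrbit ω ⊤ v = spOrbit ω ⊤ (0, 1, 0))
    (hu : u ∈ (I • ⊤ : Submodule R (R × R × P))) (h : ω.addHyperbolic.form u v = 0) :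
    ω.addHyperbolic.transvection h ∈ spOrbitPreserving ω I := by
  obtain ⟨k, hk, x, hx, rfl, rfl⟩ := exists_mem_ETransSp_apply_eq hv hu h
  have h₀ : ω.addHyperbolic.form (0, x) (0, 1, 0) = 0 := by simp
  rw [← ω.addHyperbolic.conj_transvection (formQ_map hk) h₀, ← linE_eq_transvection]
  exact conj_mem_orbitPreserving (le_normalizer_relNormalClosure hk)
    (linE_mem_spOrbitPreserving h2 hx)

theorem transvection_mul_transvection_mem_ETransSpRel {u v : R × R × P}
    (hv : spOrbit ω ⊤ v = spOrbit ω ⊤ (0, 1, 0))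
    (hu : u ∈ (I • ⊤ : Submodule R (R × R × P))) (h : ω.addHyperbolic.form u v = 0)
    (h' : ω.addHyperbolic.form v u = 0) :
    ω.addHyperbolic.transvection h * ω.addHyperbolic.transvection h' ∈ ETransSpRel ω I := by
  obtain ⟨k, hk, ⟨c, q⟩, hx, rfl, rfl⟩ := exists_mem_ETransSp_apply_eq hv hu h
  have hc : c ∈ I := dual_apply_mem (LinearMap.fst R R P) hx
  have hq : q ∈ (I • ⊤ : Submodule R P) := map_mem_smul_top (LinearMap.snd R R P) hx
  have h₀ : ω.addHyperbolic.form (0, c, q) (0, 1, 0) = 0 := by simp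
  have h₁ : ω.addHyperbolic.form (0, 1, 0) (0, c, q) = 0 := by simp
  rw [← ω.addHyperbolic.conj_transvection (formQ_map hk) h₀,
    ← ω.addHyperbolic.conj_transvection (formQ_map hk) h₁, ← linE_eq_transvection, conj_mul,
    ← sympRho_two_mul]
  exact conj_mem_relNormalClosure hk (sympRho_mem_ETransSpRel hq (I.mul_mem_left 2 hc))

theorem transvection_mem_spOrbitPreserving_of_functional_mem (h2 : IsUnit (2 : R))
    {u v : R × R × P} (hv : spOrbit ω ⊤ v = spOrbit ω ⊤ (0, 1, 0))
    (hu : u ∈ (I • ⊤ : Submodule R (R × R × P))) (h : ω.addHyperbolic.form v u = 0) :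
    ω.addHyperbolic.transvection h ∈ spOrbitPreserving ω I := by
  have h' := ω.addHyperbolic.form_eq_zero_comm.1 h
  have hu_mem := transvection_mem_spOrbitPreserving_of_direction_mem h2 hv hu h'
  exact (Subgroup.mul_mem_cancel_left _ hu_mem).1
    (le_orbitPreserving (transvection_mul_transvection_mem_ETransSpRel hv hu h' h))

theorem ETrans_le_spOrbitPreserving (h2 : IsUnit (2 : R)) (ω : SymplecticForm R P) :
    ETrans R (R × P) ≤ spOrbitPreserving ω ⊤ := by
  refine (Subgroup.closure_le _).2 ?_
  rintro _ (⟨x, rfl⟩ | ⟨τ, rfl⟩)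
  · exact linE_mem_spOrbitPreserving h2 (by simp)
  · obtain ⟨w, hw, h, hτ⟩ := exists_linEStar_eq_transvection (I := ⊤) ω (τ := τ) (by simp)
    exact hτ ▸ transvection_mem_spOrbitPreserving_of_functional_mem h2
      spOrbit_top_one_zero_zero hw h

theorem exists_contragredient_mem_spOrbitPreserving (h2 : IsUnit (2 : R))
    (ω : SymplecticForm R P) {g : (R × R × P) ≃ₗ[R] (R × R × P)} (hg : g ∈ ETrans R (R × P)) :
    ∃ g' ∈ spOrbitPreserving ω ⊤,
      ∀ y z, ω.addHyperbolic.form (g y) (g' z) = ω.addHyperbolic.form y z := by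
  have htop (u : R × R × P) : u ∈ ((⊤ : Ideal R) • ⊤ : Submodule R (R × R × P)) := by simp
  induction hg using Subgroup.closure_induction with
  | mem g hg =>
    rcases hg with ⟨x, rfl⟩ | ⟨τ, rfl⟩
    · rw [linE_eq_transvection ω x]
      exact ⟨_, transvection_mem_spOrbitPreserving_of_functional_mem h2 rfl (htop (0, x))
        (by simp),
        ω.addHyperbolic.form_transvection_transvection _ _⟩
    · obtain ⟨w, hw, h, hτ⟩ := exists_linEStar_eq_transvection (I := ⊤) ω (τ := τ) (by simp)
      rw [hτ]
      have h' := ω.addHyperbolic.form_eq_zero_comm.1 h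
      exact ⟨_, transvection_mem_spOrbitPreserving_of_direction_mem h2
        spOrbit_top_one_zero_zero hw h',
        ω.addHyperbolic.form_transvection_transvection _ _⟩
  | one => exact ⟨1, one_mem _, fun _ _ => rfl⟩
  | mul g h _ _ hg hh =>
    obtain ⟨g', hg', hgg'⟩ := hg
    obtain ⟨h', hh', hhh'⟩ := hh
    exact ⟨g' * h', mul_mem hg' hh', fun y z => (hgg' _ _).trans (hhh' _ _)⟩
  | inv g _ hg =>
    obtain ⟨g', hg', hgg'⟩ := hg
    refine ⟨g'⁻¹, inv_mem hg', fun y z => ?_⟩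
    simpa [← LinearEquiv.mul_apply] using (hgg' (g⁻¹ y) (g'⁻¹ z)).symm

theorem ETransRel_le_spOrbitPreserving (h2 : IsUnit (2 : R)) (ω : SymplecticForm R P)
    (I : Ideal R) : ETransRel (R × P) I ≤ spOrbitPreserving ω I := by
  refine relNormalClosure_closure_le fun g hg s hs => ?_
  obtain ⟨g', hg', hgg'⟩ := exists_contragredient_mem_spOrbitPreserving h2 ω hg
  rcases hs with ⟨x, hx, rfl⟩ | ⟨τ, hτ, rfl⟩
  · rw [linE_eq_transvection ω x, ω.addHyperbolic.conj_transvection hgg']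
    have he : (0, 1, 0) ∈ unimodularVectors R (R × R × P) :=
      ⟨LinearMap.fst R R P ∘ₗ LinearMap.snd R R (R × P), rfl⟩
    exact transvection_mem_spOrbitPreserving_of_direction_mem h2 (hg' _ he)
      (map_mem_smul_top g.toLinearMap (mk_mem_smul_top (zero_mem _) hx)) _
  · obtain ⟨w, hw, h, hτw⟩ := exists_linEStar_eq_transvection ω hτ
    rw [hτw, ω.addHyperbolic.conj_transvection hgg']
    have he : (1, 0, 0) ∈ unimodularVectors R (R × R × P) := ⟨LinearMap.fst R R (R × P), rfl⟩
    exact transvection_mem_spOrbitPreserving_of_functional_mem h2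
      ((ETrans_le_spOrbitPreserving h2 ω hg _ he).trans spOrbit_top_one_zero_zero)
      (map_mem_smul_top g'.toLinearMap hw) _

end OrbitComparison

end TransvectionOrbits

open TransvectionOrbits in
theorem mainTheorem1_general {R : Type*} [CommRing R] (h2 : IsUnit (2 : R)) (I : Ideal R)
    {P : Type*} [AddCommGroup P] [Module R P] (ω : SymplecticForm R P) {v : R × R × P}
    (hv : v ∈ unimodularVectors R (R × R × P)) :
    MulAction.orbit (ETransRel (R × P) I) v = MulAction.orbit (ETransSpRel ω I) v := by
  apply Set.Subset.antisymm
  · rintro _ ⟨⟨g, hg⟩, rfl⟩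
    exact MulAction.orbit_eq_iff.1 (ETransRel_le_spOrbitPreserving h2 ω I hg v hv)
  · rintro _ ⟨⟨g, hg⟩, rfl⟩
    exact ⟨⟨g, ETransSpRel_le_ETransRel ω I hg⟩, rfl⟩

theorem mainTheorem1 {R : Type*} [CommRing R] (h2 : IsUnit (2 : R)) (I : Ideal R)
    {P : Type*} [AddCommGroup P] [Module R P] [Module.Finite R P] [Module.Projective R P]
    (n : ℕ) (hn : 1 ≤ n) (hrank : ∀ 𝔭 : PrimeSpectrum R, Module.rankAtStalk P 𝔭 = 2 * n)
    (ω : TransvectionOrbits.SymplecticForm R P)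
    (hω : TransvectionOrbits.LocallyCongruentPsi ω I n)
    (a b : R) (p : P) (hv : (a, b, p) ∈ TransvectionOrbits.UmRel I ((1, 0, 0) : R × R × P)) :
    MulAction.orbit (TransvectionOrbits.ETransRel (R × P) I) (a, b, p) =
      MulAction.orbit (TransvectionOrbits.ETransSpRel ω I) (a, b, p) :=
  mainTheorem1_general h2 I ω hv.1.mem_unimodularVectors
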